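/- Let $G$ be a countable residually finite group, and let $\widehat G=\varprojlim G/N$ (over the finite index normal subgroups $N$ of $G$) be its profinite completion. Let $G$ act on $2^G=\{0,1\}^G$ by the left shift $(g\cdot x)(h)=x(g^{-1}h)$. Let $K(2^G)$ be the space of compact subsets of $2^G$ with the Vietoris topology, and let $S(G)\subseteq K(2^G)$ be the subspace of subshifts, i.e. of closed $G$-invariant subsets of $2^G$. A word $x\in 2^G$ is Toeplitz if $x\colon G\to\{0,1\}$ is continuous for the profinite topology on $G$, and a subshift is Toeplitz if it is of the form $\overline{G\cdot x}$ for some Toeplitz word $x$. Then the set $$\mathrm{Top}(G)=\{S\in S(G): S\text{ is a Toeplitz subshift}\}$$ is Borel in $S(G)$. If moreover $\widehat G$ is metrizable, then for every closed subgroup $K\le\widehat G$ the set $$\mathrm{Top}(G,K)=\{S\in K(2^G): S\text{ is a Toeplitz subshift whose maximal equicontinuous factor is isomorphic to } \widehat G/K\}$$ is Borel in $K(2^G)$. Here $G$ acts on the space of left cosets $\widehat G/K$ by left translations through the canonical map $G\to\widehat G$, and the maximal equicontinuous factor of a $G$-system is its largest equicontinuous compact Hausdorff factor, i.e. the one through which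 all the others factor. -/

import Mathlib

open Set Topology TopologicalSpace MeasureTheory

universe u

/-- The profinite topology on a group `G`: a set is open when with each point `g` it contains a
coset `gH` of a finite index subgroup `H`. -/
@[reducible]
def profiniteTopology (G : Type u) [Group G] : TopologicalSpace G where
  IsOpen U := ∀ g ∈ U, ∃ H : Subgroup G, H.FiniteIndex ∧ ∀ h ∈ H, g * h ∈ U
  isOpen_univ := fun _ _ => ⟨⊤, inferInstance, fun _ _ => trivial⟩
  isOpen_inter := by
    intro U V hU hV g hg
    obtain ⟨H, hH, hHU⟩ := hU g hg.1
    obtain ⟨L, hL, hLV⟩ := hV g hg.2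
    exact ⟨H ⊓ L, inferInstance, fun h hh => ⟨hHU h hh.1, hLV h hh.2⟩⟩
  isOpen_sUnion := by
    intro 𝒰 h𝒰 g hg
    obtain ⟨U, hU, hgU⟩ := hg
    obtain ⟨H, hH, hHU⟩ := h𝒰 U hU g hgU
    exact ⟨H, hH, fun h hh => ⟨U, hU, hHU h hh⟩⟩

/-- The left shift on words: `(g · x)(h) = x(g⁻¹h)`. -/
def shift {G : Type u} [Group G] (g : G) (x : G → Bool) : G → Bool :=
  fun h => x (g⁻¹ * h)

/-- A word is Toeplitz if it is continuous for the profinite topology on `G`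
(and the discrete topology on the two symbols). -/
def IsToeplitzWord {G : Type u} [Group G] (x : G → Bool) : Prop :=
  @Continuous G Bool (profiniteTopology G) _ x

/-- A closed (equivalently, compact) subset of `2^G` is a subshift if it is invariant under the
left shift. -/
def IsSubshift {G : Type u} [Group G] (C : Compacts (G → Bool)) : Prop :=
  ∀ g : G, ∀ x ∈ C, shift g x ∈ C

/-- The space `S(G)` of all `G`-subshifts, a subspace of the hyperspace `K(2^G)` of compact sets,
which Mathlib equips with the Vietoris topology. -/
abbrev SubshiftSpace (G : Type u) [Group G] : Type u :=
  {C : Compacts (G → Bool) // IsSubshift C}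

/-- A subshift is Toeplitz if it is the orbit closure of a Toeplitz word. -/
def IsToeplitzSubshift {G : Type u} [Group G] (S : SubshiftSpace G) : Prop :=
  ∃ x : G → Bool, IsToeplitzWord x ∧
    (S.1 : Set (G → Bool)) = closure (range fun g : G => shift g x)

/-- The set `Top(G)` of all Toeplitz subshifts. -/
def toeplitzSubshifts (G : Type u) [Group G] : Set (SubshiftSpace G) :=
  {S | IsToeplitzSubshift S}

/-- The points of a subshift, as a topological space in its own right. -/
def SubshiftSpace.Points {G : Type u} [Group G] (S : SubshiftSpace G) : Type u :=
  {x : G → Bool // x ∈ S.1}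

instance {G : Type u} [Group G] (S : SubshiftSpace G) : TopologicalSpace S.Points :=
  inferInstanceAs (TopologicalSpace {x : G → Bool // x ∈ S.1})

/-- The shift action of `G` on a subshift. -/
instance {G : Type u} [Group G] (S : SubshiftSpace G) : MulAction G S.Points where
  smul g x := ⟨shift g x.1, S.2 g x.1 x.2⟩
  one_smul x := Subtype.ext (by
    funext h
    change x.1 (1⁻¹ * h) = x.1 h
    simp)
  mul_smul a b x := Subtype.ext (by
    funext h
    change x.1 ((a * b)⁻¹ * h) = x.1 (b⁻¹ * (a⁻¹ * h))
    simp [mul_assoc])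

/-- Factor maps between `G`-systems: continuous equivariant surjections. -/
structure IsFactorMap (G : Type u) [Group G] {X Y : Type u} [TopologicalSpace X] [MulAction G X]
    [TopologicalSpace Y] [MulAction G Y] (π : X → Y) : Prop where
  continuous : Continuous π
  surjective : Function.Surjective π
  map_smul : ∀ (g : G) (x : X), π (g • x) = g • π x

/-- Equicontinuity of an action of `G` on a compact Hausdorff space `Y`: the maps `y ↦ g • y` are
uniformly equicontinuous. The entourages of the unique compatible uniformity on a compact
Hausdorff space are the neighbourhoods of the diagonal. -/
def IsEquicontinuousSystem (G : Type u) [Group G] (Y : Type u) [TopologicalSpace Y]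
    [MulAction G Y] : Prop :=
  ∀ V ∈ 𝓝ˢ (diagonal Y), ∃ U ∈ 𝓝ˢ (diagonal Y), ∀ p ∈ U, ∀ g : G, (g • p.1, g • p.2) ∈ V

/-- `π : X → Y` exhibits `Y` as the maximal equicontinuous factor of `X`: it is an equicontinuous
factor of `X`, and every equicontinuous (compact Hausdorff) factor of `X` is a factor of `Y`
through `π`. -/
structure IsMaximalEquicontinuousFactor (G : Type u) [Group G] {X Y : Type u}
    [TopologicalSpace X] [MulAction G X] [TopologicalSpace Y] [MulAction G Y]
    (π : X → Y) : Prop where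
  isFactorMap : IsFactorMap G π
  equicontinuous : IsEquicontinuousSystem G Y
  maximal : ∀ (Z : Type u) [TopologicalSpace Z] [CompactSpace Z] [T2Space Z] [MulAction G Z]
    (φ : X → Z), IsFactorMap G φ → IsEquicontinuousSystem G Z →
      ∃ ψ : Y → Z, IsFactorMap G ψ ∧ ∀ x, ψ (π x) = φ x

/-- The profinite completion `Ĝ` of `G`, the inverse limit of the finite quotients of `G`. -/
abbrev ProfCompletion (G : Type u) [Group G] : ProfiniteGrp.{u} :=
  ProfiniteGrp.ProfiniteCompletion.completion (GrpCat.of G)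

/-- The canonical homomorphism from `G` to its profinite completion. -/
def toProfCompletion (G : Type u) [Group G] : G →* ProfCompletion G :=
  (ProfiniteGrp.ProfiniteCompletion.eta (GrpCat.of G)).hom

/-- The space `Ĝ/K` of left cosets of `K` in the profinite completion, as a `G`-system. -/
def ProfCosetSpace {G : Type u} [Group G] (K : Subgroup (ProfCompletion G)) : Type u :=
  ProfCompletion G ⧸ K

instance {G : Type u} [Group G] (K : Subgroup (ProfCompletion G)) :
    TopologicalSpace (ProfCosetSpace K) :=
  inferInstanceAs (TopologicalSpace (ProfCompletion G ⧸ K))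

/-- `G` acts on `Ĝ/K` by left translations through the canonical homomorphism `G → Ĝ`. -/
instance {G : Type u} [Group G] (K : Subgroup (ProfCompletion G)) :
    MulAction G (ProfCosetSpace K) :=
  MulAction.compHom (ProfCompletion G ⧸ K) (toProfCompletion G)

/-- The set `Top(G, K)` of all Toeplitz subshifts whose maximal equicontinuous factor is
(isomorphic to) `Ĝ/K`, as a subset of `K(2^G)`. -/
def toeplitzSubshiftsWithMEF {G : Type u} [Group G] (K : Subgroup (ProfCompletion G)) :
    Set (Compacts (G → Bool)) :=
  {C | ∃ hC : IsSubshift C, IsToeplitzSubshift ⟨C, hC⟩ ∧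
    ∃ π : SubshiftSpace.Points ⟨C, hC⟩ → ProfCosetSpace K, IsMaximalEquicontinuousFactor G π}

/-!
The proof describes both sets by countably many conditions of the form "`C` meets the open set
`U`", each of which is open in the Vietoris topology.

For `Top(G)`, fix `g : G` and a finite set `T ⊆ G`. The words which are constant on `gH` for some
subgroup `H` with `G = TH` form a closed set, because the subgroups of `G` form a compact space;
so there is no need to quantify over the possibly uncountably many finite index subgroups. If a
Toeplitz word `x` has dense orbit in `S` and `H` has finite index, then `x` is interior to the
closure of `H • x`, since finitely many translates of that closure cover `S`. Hence in a Toeplitz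
subshift the words that are locally periodic at `g` have dense interior. Conversely, in a
topologically transitive subshift with this property, the Baire category theorem produces a
Toeplitz word with dense orbit (`isToeplitzSubshift_iff`).

For `Top(G, K)`, a Toeplitz word `x` is regularly recurrent: `g • x → x` as `g → 1` in `Ĝ`. Let `Q`
be the closure of `{(g • x, g)}` in `S × Ĝ`. Regular recurrence implies that the fibre of `Q` over
`x` is a closed subgroup `L`, that the fibres over the other points are left cosets of `L`, and
that an equicontinuous factor identifies any two points related by `Q` to the same element of `Ĝ`;
so `Q` induces a map `S → Ĝ/L`, which is the maximal equicontinuous factor. As `S` has `Ĝ/V` as a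
factor, for `V` open, exactly when `V` contains a conjugate of `L`, and as a compactness argument
recovers the conjugacy class of `L` from these `V`, the maximal equicontinuous factor is `Ĝ/K` if
and only if `S` has the same finite factors `Ĝ/V` as `Ĝ/K`
(`IsRegularlyRecurrent.exists_isMaximalEquicontinuousFactor_iff`). If `Ĝ` is metrizable, there are
countably many open subgroups `V`, and a factor map onto the finite set `Ĝ/V` is one of countably
many block maps, so this condition is Borel.
-/

/-! ### Open and closed subgroups of profinite groups -/

/-- A closed subgroup of a profinite group is the intersection of the open subgroups containing
it. -/
theorem Subgroup.mem_of_forall_openSubgroup_le {Γ : Type*} [Group Γ] [TopologicalSpace Γ]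
    [IsTopologicalGroup Γ] [CompactSpace Γ] [TotallyDisconnectedSpace Γ] {K : Subgroup Γ}
    (hK : IsClosed (K : Set Γ)) {γ : Γ}
    (h : ∀ V : OpenSubgroup Γ, K ≤ (V : Subgroup Γ) → γ ∈ V) : γ ∈ K := by
  by_contra hγ
  have hO : {n : Γ | γ * n⁻¹ ∉ K} ∈ 𝓝 (1 : Γ) := by
    refine IsOpen.mem_nhds ?_ (by simpa using hγ)
    exact hK.isOpen_compl.preimage (f := fun n : Γ => γ * n⁻¹) (by fun_prop)
  obtain ⟨U, hUO, hU, hU1⟩ := mem_nhds_iff.1 hO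
  obtain ⟨N, hN⟩ := ProfiniteGrp.exist_openNormalSubgroup_sub_open_nhds_of_one hU hU1
  have hV : IsOpen ((K ⊔ N.toSubgroup : Subgroup Γ) : Set Γ) :=
    Subgroup.isOpen_mono le_sup_right N.isOpen'
  have hmem : γ ∈ K ⊔ N.toSubgroup := h ⟨K ⊔ N.toSubgroup, hV⟩ le_sup_left
  rw [← SetLike.mem_coe, Subgroup.mul_normal] at hmem
  obtain ⟨k, hk, n, hn, rfl⟩ := hmem
  exact hUO (hN hn) (by simpa using hk)

/-- If every open subgroup containing `L` contains a conjugate of `K`, then so does `L`: the sets of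
conjugating elements are closed and directed. -/
theorem Subgroup.exists_conj_le_of_forall_openSubgroup {Γ : Type*} [Group Γ] [TopologicalSpace Γ]
    [IsTopologicalGroup Γ] [CompactSpace Γ] [TotallyDisconnectedSpace Γ] {K L : Subgroup Γ}
    (hL : IsClosed (L : Set Γ))
    (h : ∀ V : OpenSubgroup Γ, L ≤ (V : Subgroup Γ) → ∃ c : Γ, ∀ k ∈ K, c * k * c⁻¹ ∈ V) :
    ∃ c : Γ, ∀ k ∈ K, c * k * c⁻¹ ∈ L := by
  let A : {V : OpenSubgroup Γ // L ≤ (V : Subgroup Γ)} → Set Γ :=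
    fun V => {c | ∀ k ∈ K, c * k * c⁻¹ ∈ V.1}
  have hA : ∀ V, IsClosed (A V) := fun V => by
    simp only [A, ofPred_forall]
    exact isClosed_biInter fun k _ => V.1.isClosed.preimage
      (f := fun c : Γ => c * k * c⁻¹) (by fun_prop)
  have hdir : Directed (· ⊇ ·) A := fun V W =>
    ⟨⟨V.1 ⊓ W.1, le_inf V.2 W.2⟩, fun c hc k hk => (hc k hk).1, fun c hc k hk => (hc k hk).2⟩
  have : Nonempty {V : OpenSubgroup Γ // L ≤ (V : Subgroup Γ)} := ⟨⟨⊤, le_top⟩⟩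
  obtain ⟨c, hc⟩ := IsCompact.nonempty_iInter_of_directed_nonempty_isCompact_isClosed A hdir
    (fun V => h V.1 V.2) (fun V => (hA V).isCompact) hA
  rw [mem_iInter] at hc
  exact ⟨c, fun k hk => L.mem_of_forall_openSubgroup_le hL fun V hV => hc ⟨V, hV⟩ k hk⟩

/-- A closed subgroup of a compact group cannot be conjugated into a proper subgroup of itself:
`g⁻¹` is a limit of positive powers of `g`. -/
theorem Subgroup.conj_inv_mem_of_conj_mem {Γ : Type*} [Group Γ] [TopologicalSpace Γ]
    [IsTopologicalGroup Γ] [CompactSpace Γ] {K : Subgroup Γ} (hK : IsClosed (K : Set Γ)) {g : Γ}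
    (h : ∀ k ∈ K, g * k * g⁻¹ ∈ K) : ∀ k ∈ K, g⁻¹ * k * g ∈ K := by
  intro k hk
  have hpow : ∀ n : ℕ, g ^ n * k * (g ^ n)⁻¹ ∈ K := by
    intro n
    induction n with
    | zero => simpa using hk
    | succ n ih =>
      have := h _ ih
      rwa [show g ^ (n + 1) * k * (g ^ (n + 1))⁻¹ = g * (g ^ n * k * (g ^ n)⁻¹) * g⁻¹ by
        rw [pow_succ']; group]
  have hcl : IsClosed {c : Γ | c * k * c⁻¹ ∈ K} :=
    hK.preimage (f := fun c : Γ => c * k * c⁻¹) (by fun_prop)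
  have hmem : g⁻¹ ∈ _root_.closure (range fun n : ℕ => g ^ n) := by
    rw [← closure_range_zpow_eq_pow]
    exact _root_.subset_closure ⟨-1, by simp⟩
  have hsub : (range fun n : ℕ => g ^ n) ⊆ {c : Γ | c * k * c⁻¹ ∈ K} :=
    range_subset_iff.2 hpow
  have := hcl.closure_subset_iff.2 hsub hmem
  simpa using this

theorem countable_openSubgroup (Γ : Type*) [Group Γ] [TopologicalSpace Γ]
    [IsTopologicalGroup Γ] [CompactSpace Γ] [T2Space Γ] [TotallyDisconnectedSpace Γ]
    [MetrizableSpace Γ] : Countable (OpenSubgroup Γ) := by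
  let _ := metrizableSpaceMetric Γ
  have : Countable (Clopens Γ) := Clopens.countable_iff_secondCountable.2 inferInstance
  refine Function.Injective.countable (f := fun V : OpenSubgroup Γ => (⟨V, V.isClopen⟩ : Clopens Γ))
    fun V W h => ?_
  exact SetLike.coe_injective (congrArg Clopens.carrier h)

theorem denseRange_toProfCompletion (G : Type u) [Group G] :
    DenseRange (toProfCompletion G) :=
  ProfiniteGrp.ProfiniteCompletion.denseRange (GrpCat.of G)

/-- The profinite topology on `G` is induced from `Ĝ`: finite index subgroups are neighbourhoods of
the identity for the induced topology. -/
theorem comap_toProfCompletion_nhds_one_le {G : Type u} [Group G] (H : Subgroup G)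
    [H.FiniteIndex] : (H : Set G) ∈ Filter.comap (toProfCompletion G) (𝓝 1) := by
  let N : FiniteIndexNormalSubgroup G := FiniteIndexNormalSubgroup.ofSubgroup H.normalCore
  let _ : TopologicalSpace (G ⧸ H.normalCore) := ⊥
  have : DiscreteTopology (G ⧸ H.normalCore) := ⟨rfl⟩
  let p : ProfCompletion G → G ⧸ H.normalCore := fun γ => γ.1 N
  have hp : Continuous p := (continuous_apply N).comp continuous_subtype_val
  refine ⟨p ⁻¹' {1}, ?_, ?_⟩
  · exact (isOpen_discrete _ |>.preimage hp).mem_nhds rfl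
  · intro g hg
    have : ((g : G) : G ⧸ H.normalCore) = 1 := hg
    exact H.normalCore_le ((QuotientGroup.eq_one_iff g).1 this)

/-! ### The coset spaces of the profinite completion as `G`-systems -/

section Coset

variable {G : Type u} [Group G]

/-- The projection `Ĝ → Ĝ/K`. -/
def cosetMk (K : Subgroup (ProfCompletion G)) (γ : ProfCompletion G) : ProfCosetSpace K :=
  (QuotientGroup.mk γ : ProfCompletion G ⧸ K)

theorem cosetMk_eq_iff {K : Subgroup (ProfCompletion G)} {γ δ : ProfCompletion G} :
    cosetMk K γ = cosetMk K δ ↔ γ⁻¹ * δ ∈ K :=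
  QuotientGroup.eq

theorem cosetMk_surjective (K : Subgroup (ProfCompletion G)) :
    Function.Surjective (cosetMk K) :=
  QuotientGroup.mk_surjective

theorem isQuotientMap_cosetMk (K : Subgroup (ProfCompletion G)) : IsQuotientMap (cosetMk K) :=
  QuotientGroup.isQuotientMap_mk K

theorem smul_cosetMk (K : Subgroup (ProfCompletion G)) (g : G) (γ : ProfCompletion G) :
    g • cosetMk K γ = cosetMk K (toProfCompletion G g * γ) :=
  rfl

instance (K : Subgroup (ProfCompletion G)) : CompactSpace (ProfCosetSpace K) :=
  inferInstanceAs (CompactSpace (ProfCompletion G ⧸ K))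

instance (K : Subgroup (ProfCompletion G)) : Nonempty (ProfCosetSpace K) :=
  ⟨cosetMk K 1⟩

instance (V : OpenSubgroup (ProfCompletion G)) :
    DiscreteTopology (ProfCosetSpace (V : Subgroup (ProfCompletion G))) :=
  inferInstanceAs (DiscreteTopology (ProfCompletion G ⧸ V.toSubgroup))

instance (V : OpenSubgroup (ProfCompletion G)) :
    Finite (ProfCosetSpace (V : Subgroup (ProfCompletion G))) :=
  finite_of_compact_of_discrete

/-- Left translations by the compact group `Ĝ` are equicontinuous, hence so are those by `G`. -/
theorem isEquicontinuousSystem_profCosetSpace (K : Subgroup (ProfCompletion G)) :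
    IsEquicontinuousSystem G (ProfCosetSpace K) := by
  intro V hV
  let Y := ProfCompletion G ⧸ K
  have hcont : Continuous fun q : (Y × Y) × ProfCompletion G => (q.2 • q.1.1, q.2 • q.1.2) := by
    fun_prop
  obtain ⟨W, hW, hdW, hWV⟩ := mem_nhdsSet_iff_exists.1 hV
  have hopen : IsOpen {p : Y × Y | ∀ γ : ProfCompletion G, (γ • p.1, γ • p.2) ∈ W} := by
    refine isOpen_iff_mem_nhds.2 fun p hp => ?_
    have := isCompact_univ.eventually_forall_of_forall_eventually (x₀ := p)
      (P := fun p γ => ((γ : ProfCompletion G) • p.1, γ • p.2) ∈ W)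
      fun γ _ => (hW.preimage hcont).mem_nhds (hp γ)
    exact this.mono fun p hp γ => hp γ (mem_univ _)
  refine ⟨_, hopen.mem_nhdsSet.2 ?_, fun p hp g => hWV (hp (toProfCompletion G g))⟩
  rintro ⟨p, _⟩ (rfl : p = _) γ
  exact hdW rfl

theorem IsFactorMap.comp {X Y Z : Type u} [TopologicalSpace X] [MulAction G X]
    [TopologicalSpace Y] [MulAction G Y] [TopologicalSpace Z] [MulAction G Z] {ψ : Y → Z}
    {φ : X → Y} (hψ : IsFactorMap G ψ) (hφ : IsFactorMap G φ) : IsFactorMap G (ψ ∘ φ) where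
  continuous := hψ.continuous.comp hφ.continuous
  surjective := hψ.surjective.comp hφ.surjective
  map_smul g x := by simp [hφ.map_smul, hψ.map_smul]

theorem exists_isFactorMap_profCosetSpace {K L : Subgroup (ProfCompletion G)}
    {c : ProfCompletion G} (h : ∀ k ∈ K, c * k * c⁻¹ ∈ L) :
    ∃ ψ : ProfCosetSpace K → ProfCosetSpace L, IsFactorMap G ψ := by
  let ψ : ProfCosetSpace K → ProfCosetSpace L :=
    Quotient.lift (fun γ => cosetMk L (γ * c⁻¹)) fun γ δ hγδ => by
      rw [cosetMk_eq_iff]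
      have := h _ (QuotientGroup.leftRel_apply.1 hγδ)
      convert this using 1
      group
  have hψ : ∀ γ, ψ (cosetMk K γ) = cosetMk L (γ * c⁻¹) := fun _ => rfl
  refine ⟨ψ, (isQuotientMap_cosetMk K).continuous_iff.2 ?_, fun z => ?_, fun g y => ?_⟩
  · exact (isQuotientMap_cosetMk L).continuous.comp (continuous_mul_const c⁻¹)
  · obtain ⟨γ, rfl⟩ := cosetMk_surjective L z
    exact ⟨cosetMk K (γ * c), by simp [hψ]⟩
  · obtain ⟨γ, rfl⟩ := cosetMk_surjective K y
    simp [hψ, smul_cosetMk, mul_assoc]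

theorem IsFactorMap.exists_conj_mem {K : Subgroup (ProfCompletion G)}
    {V : OpenSubgroup (ProfCompletion G)}
    {ψ : ProfCosetSpace K → ProfCosetSpace (V : Subgroup (ProfCompletion G))}
    (hψ : IsFactorMap G ψ) : ∃ c : ProfCompletion G, ∀ k ∈ K, c * k * c⁻¹ ∈ V := by
  obtain ⟨d, hd⟩ := cosetMk_surjective _ (ψ (cosetMk K 1))
  -- `ψ` commutes with `G`, hence with all of `Ĝ`, by density of `G` in `Ĝ`.
  have key : (fun γ => ψ (cosetMk K γ)) =
      fun γ => cosetMk (V : Subgroup (ProfCompletion G)) (γ * d) := by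
    refine (denseRange_toProfCompletion G).equalizer
      (hψ.continuous.comp (isQuotientMap_cosetMk K).continuous)
      ((isQuotientMap_cosetMk _).continuous.comp (continuous_mul_const d)) ?_
    funext g
    have h := hψ.map_smul g (cosetMk K 1)
    rw [← hd, smul_cosetMk, smul_cosetMk, mul_one] at h
    exact h
  refine ⟨d⁻¹, fun k hk => ?_⟩
  have h1 : cosetMk K 1 = cosetMk K k := cosetMk_eq_iff.2 (by rwa [inv_one, one_mul])
  have h2 : cosetMk (V : Subgroup (ProfCompletion G)) (1 * d) = cosetMk V.toSubgroup (k * d) := by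
    rw [← congrFun key 1, ← congrFun key k, h1]
  have h3 := cosetMk_eq_iff.1 h2
  rw [inv_inv]
  rwa [one_mul, ← mul_assoc] at h3

end Coset

/-! ### Regularly recurrent points and the correspondence with the profinite completion -/

section Correspondence

variable {G : Type u} [Group G] {X : Type u} [TopologicalSpace X] [MulAction G X]

/-- The orbit closure of `(x, 1)` in `X × Ĝ`, regarded as a correspondence between `X` and `Ĝ`: it
relates the limits of `g i • x` and of `g i` along nets `g i` in `G`. -/
def orbitCorrespondence (G : Type u) [Group G] {X : Type u} [TopologicalSpace X] [MulAction G X]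
    (x : X) : Set (X × ProfCompletion G) :=
  closure (range fun g : G => (g • x, toProfCompletion G g))

theorem isClosed_orbitCorrespondence (x : X) : IsClosed (orbitCorrespondence G x) :=
  isClosed_closure

theorem self_one_mem_orbitCorrespondence (x : X) : (x, 1) ∈ orbitCorrespondence G x :=
  subset_closure ⟨1, by simp⟩

theorem exists_smul_mem_of_mem_orbitCorrespondence {x y : X} {γ : ProfCompletion G}
    (h : (y, γ) ∈ orbitCorrespondence G x) {A : Set X} (hA : A ∈ 𝓝 y)
    {P : Set (ProfCompletion G)} (hP : P ∈ 𝓝 γ) :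
    ∃ g : G, g • x ∈ A ∧ toProfCompletion G g ∈ P := by
  obtain ⟨_, hp, g, rfl⟩ := mem_closure_iff_nhds.1 h _ (prod_mem_nhds hA hP)
  exact ⟨g, hp⟩

theorem smul_mem_orbitCorrespondence [ContinuousConstSMul G X] {x y : X} {γ : ProfCompletion G}
    (h : (y, γ) ∈ orbitCorrespondence G x) (g : G) :
    (g • y, toProfCompletion G g * γ) ∈ orbitCorrespondence G x := by
  refine map_mem_closure (f := fun p : X × ProfCompletion G =>
    (g • p.1, toProfCompletion G g * p.2)) (by fun_prop) h ?_
  rintro _ ⟨k, rfl⟩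
  exact ⟨g * k, by simp [mul_smul]⟩

theorem mul_mem_orbitCorrespondence [ContinuousConstSMul G X] {x y : X} {γ k : ProfCompletion G}
    (h : (y, γ) ∈ orbitCorrespondence G x) (hk : (x, k) ∈ orbitCorrespondence G x) :
    (y, γ * k) ∈ orbitCorrespondence G x := by
  rw [← (isClosed_orbitCorrespondence (G := G) x).closure_eq]
  refine map_mem_closure (f := fun p : X × ProfCompletion G => (p.1, p.2 * k))
    (by fun_prop) h ?_
  rintro _ ⟨g, rfl⟩
  exact smul_mem_orbitCorrespondence hk g

theorem exists_mem_orbitCorrespondence_snd [CompactSpace X] (x : X) (γ : ProfCompletion G) :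
    ∃ y, (y, γ) ∈ orbitCorrespondence G x := by
  have hcl : IsClosed (Prod.snd '' orbitCorrespondence G x) :=
    isClosedMap_snd_of_compactSpace _ (isClosed_orbitCorrespondence x)
  have : γ ∈ Prod.snd '' orbitCorrespondence G x := by
    refine hcl.closure_subset_iff.2 ?_ (denseRange_toProfCompletion G γ)
    rintro _ ⟨g, rfl⟩
    exact ⟨_, subset_closure ⟨g, rfl⟩, rfl⟩
  obtain ⟨⟨y, _⟩, h, rfl⟩ := this
  exact ⟨y, h⟩

theorem exists_mem_orbitCorrespondence_fst {x : X} (hx : DenseRange fun g : G => g • x) (y : X) :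
    ∃ γ, (y, γ) ∈ orbitCorrespondence G x := by
  have hcl : IsClosed (Prod.fst '' orbitCorrespondence G x) :=
    isClosedMap_fst_of_compactSpace _ (isClosed_orbitCorrespondence x)
  have : y ∈ Prod.fst '' orbitCorrespondence G x := by
    refine hcl.closure_subset_iff.2 ?_ (hx y)
    rintro _ ⟨g, rfl⟩
    exact ⟨_, subset_closure ⟨g, rfl⟩, rfl⟩
  obtain ⟨⟨_, γ⟩, h, rfl⟩ := this
  exact ⟨γ, h⟩

/-- A point `x` of a `G`-system is regularly recurrent if `g • x` tends to `x` as `g` tends to the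
identity in the topology induced from `Ĝ`, i.e. if the return times of `x` to each of its
neighbourhoods contain a finite index subgroup. -/
def IsRegularlyRecurrent (G : Type u) [Group G] {X : Type u} [TopologicalSpace X] [MulAction G X]
    (x : X) : Prop :=
  Filter.Tendsto (fun g : G => g • x) (Filter.comap (toProfCompletion G) (𝓝 1)) (𝓝 x)

theorem IsRegularlyRecurrent.exists_nhds_one {x : X} (hr : IsRegularlyRecurrent G x) {A : Set X}
    (hA : A ∈ 𝓝 x) :
    ∃ P ∈ 𝓝 (1 : ProfCompletion G), ∀ g : G, toProfCompletion G g ∈ P → g • x ∈ A :=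
  Filter.mem_comap.1 (hr hA)

/-- Two points of `Ĝ` over the same point of `X` differ by a point of the fibre over `x`. -/
theorem IsRegularlyRecurrent.inv_mul_mem [RegularSpace X] [ContinuousConstSMul G X] {x y : X}
    (hr : IsRegularlyRecurrent G x) {γ δ : ProfCompletion G}
    (hγ : (y, γ) ∈ orbitCorrespondence G x) (hδ : (y, δ) ∈ orbitCorrespondence G x) :
    (x, γ⁻¹ * δ) ∈ orbitCorrespondence G x := by
  refine mem_closure_iff_nhds.2 fun t ht => ?_
  obtain ⟨A, hA, O, hO, hAO⟩ := mem_nhds_prod_iff.1 ht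
  obtain ⟨C, hC, hCcl, hCA⟩ := exists_mem_nhds_isClosed_subset (interior_mem_nhds.2 hA)
  obtain ⟨P, hP, hPC⟩ := hr.exists_nhds_one hC
  -- An element of `G` near `γ⁻¹` moves `y` into `C`, and `(y, δ)` close to `(x, γ⁻¹ * δ)`.
  obtain ⟨g, hg⟩ := (denseRange_toProfCompletion G).exists_mem_open
    (s := interior {ε | ε * γ ∈ interior P ∧ ε * δ ∈ interior O}) isOpen_interior ⟨γ⁻¹, by
      rw [mem_interior_iff_mem_nhds]
      refine Filter.inter_mem ?_ ?_
      · exact (isOpen_interior.preimage (continuous_mul_const γ)).mem_nhds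
          (by simpa [mem_interior_iff_mem_nhds] using hP)
      · exact (isOpen_interior.preimage (continuous_mul_const δ)).mem_nhds
          (by simpa [mem_interior_iff_mem_nhds] using hO)⟩
  obtain ⟨hgP, hgO⟩ := interior_subset hg
  have hgC : g • y ∈ C := by
    by_contra hn
    obtain ⟨k, hkC, hkP⟩ := exists_smul_mem_of_mem_orbitCorrespondence
      (smul_mem_orbitCorrespondence hγ g) (hCcl.isOpen_compl.mem_nhds hn)
      (mem_interior_iff_mem_nhds.1 hgP)
    exact hkC (hPC k hkP)
  obtain ⟨k, hkA, hkO⟩ := exists_smul_mem_of_mem_orbitCorrespondence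
    (smul_mem_orbitCorrespondence hδ g) (mem_interior_iff_mem_nhds.1 (hCA hgC))
    (mem_interior_iff_mem_nhds.1 hgO)
  exact ⟨_, hAO ⟨hkA, hkO⟩, k, rfl⟩

/-! ### The maximal equicontinuous factor of a regularly recurrent orbit closure -/

section MaximalEquicontinuousFactor

variable {G : Type u} [Group G] {X : Type u} [TopologicalSpace X] [MulAction G X]

/-- Points of `X` lying over the same point of `Ĝ` are identified by every equicontinuous factor
of `X`. -/
theorem IsRegularlyRecurrent.factor_eq {x y z : X} (hr : IsRegularlyRecurrent G x)
    {γ : ProfCompletion G} (hy : (y, γ) ∈ orbitCorrespondence G x)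
    (hz : (z, γ) ∈ orbitCorrespondence G x)
    {Z : Type u} [TopologicalSpace Z] [CompactSpace Z] [T2Space Z] [MulAction G Z] {φ : X → Z}
    (hφ : IsFactorMap G φ) (he : IsEquicontinuousSystem G Z) : φ y = φ z := by
  by_contra hne
  obtain ⟨A, hyA, hA, B, hzB, hB, hAB⟩ := exists_open_nhds_disjoint_closure hne
  have hV : (closure A ×ˢ closure B)ᶜ ∈ 𝓝ˢ (diagonal Z) := by
    refine (isClosed_closure.prod isClosed_closure).isOpen_compl.mem_nhdsSet.2 ?_
    rintro ⟨a, _⟩ (rfl : a = _) hmem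
    exact disjoint_left.1 hAB hmem.1 hmem.2
  obtain ⟨U, hU, hUV⟩ := he _ hV
  have hC : {w | (φ x, φ w) ∈ U} ∈ 𝓝 x :=
    (continuous_const.prodMk hφ.continuous).continuousAt.preimage_mem_nhds
      (mem_nhdsSet_iff_forall.1 hU (φ x, φ x) rfl)
  obtain ⟨P, hP, hPC⟩ := hr.exists_nhds_one hC
  have hdiv : {p : ProfCompletion G × ProfCompletion G | p.1⁻¹ * p.2 ∈ P} ∈ 𝓝 (γ, γ) := by
    refine ContinuousAt.preimage_mem_nhds
      (f := fun p : ProfCompletion G × ProfCompletion G => p.1⁻¹ * p.2) ?_ ?_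
    · exact (continuous_fst.inv.mul continuous_snd).continuousAt
    · rwa [inv_mul_cancel]
  obtain ⟨O₁, hO₁, O₂, hO₂, hO⟩ := mem_nhds_prod_iff.1 hdiv
  obtain ⟨g, hgA, hgO⟩ := exists_smul_mem_of_mem_orbitCorrespondence hy
    (hφ.continuous.continuousAt.preimage_mem_nhds (hA.mem_nhds hyA)) hO₁
  obtain ⟨h, hhB, hhO⟩ := exists_smul_mem_of_mem_orbitCorrespondence hz
    (hφ.continuous.continuousAt.preimage_mem_nhds (hB.mem_nhds hzB)) hO₂
  -- `g⁻¹ * h` is close to the identity, so `(φ x, φ (g⁻¹ • h • x))` lies in `U`; translating by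
  -- `g` gives `(φ (g • x), φ (h • x))`, which lies in `A ×ˢ B`.
  have hmem : toProfCompletion G (g⁻¹ * h) ∈ P := by
    rw [map_mul, map_inv]
    exact hO (mk_mem_prod hgO hhO)
  have := hUV _ (hPC _ hmem) g
  refine this ⟨subset_closure ?_, subset_closure ?_⟩
  · change g • φ x ∈ A
    rw [← hφ.map_smul]
    exact hgA
  · change g • φ ((g⁻¹ * h) • x) ∈ B
    rw [← hφ.map_smul, smul_smul, mul_inv_cancel_left]
    exact hhB

/-- If the fibre of the correspondence over a regularly recurrent point is a conjugate of `K`,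
then the correspondence, translated on the right, is the graph of a map onto `Ĝ/K`, and this map
is the maximal equicontinuous factor. -/
theorem IsRegularlyRecurrent.exists_isMaximalEquicontinuousFactor [CompactSpace X] [T2Space X]
    [ContinuousConstSMul G X] {x : X} (hr : IsRegularlyRecurrent G x)
    (hx : DenseRange fun g : G => g • x) {K : Subgroup (ProfCompletion G)} {c : ProfCompletion G}
    (hK : ∀ γ, γ ∈ K ↔ (x, c * γ * c⁻¹) ∈ orbitCorrespondence G x) :
    ∃ π : X → ProfCosetSpace K, IsMaximalEquicontinuousFactor G π := by
  choose τ hτ using exists_mem_orbitCorrespondence_fst hx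
  let π : X → ProfCosetSpace K := fun y => cosetMk K (τ y * c)
  have hπ : ∀ y γ, π y = cosetMk K (γ * c) ↔ (y, γ) ∈ orbitCorrespondence G x := by
    intro y γ
    have hfib : π y = cosetMk K (γ * c) ↔ (x, (τ y)⁻¹ * γ) ∈ orbitCorrespondence G x := by
      rw [cosetMk_eq_iff, hK]
      simp [mul_assoc]
    rw [hfib]
    refine ⟨fun h => ?_, hr.inv_mul_mem (hτ y)⟩
    simpa using mul_mem_orbitCorrespondence (hτ y) h
  have hcont : Continuous π := by
    refine continuous_iff_isClosed.2 fun A hA => ?_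
    have : π ⁻¹' A = Prod.fst '' (orbitCorrespondence G x ∩
        {p : X × ProfCompletion G | cosetMk K (p.2 * c) ∈ A}) := by
      ext y
      constructor
      · exact fun hy => ⟨(y, τ y), ⟨hτ y, hy⟩, rfl⟩
      · rintro ⟨⟨y, γ⟩, ⟨h, hA⟩, rfl⟩
        rw [mem_preimage, (hπ y γ).2 h]
        exact hA
    rw [this]
    refine isClosedMap_fst_of_compactSpace _ ((isClosed_orbitCorrespondence x).inter ?_)
    exact hA.preimage ((isQuotientMap_cosetMk K).continuous.comp
      ((continuous_mul_const c).comp continuous_snd))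
  have hclosed : IsClosedMap π := by
    intro B hB
    rw [← (isQuotientMap_cosetMk K).isClosed_preimage]
    have : cosetMk K ⁻¹' (π '' B) = (fun δ => δ * c⁻¹) ⁻¹'
        (Prod.snd '' (orbitCorrespondence G x ∩ Prod.fst ⁻¹' B)) := by
      ext δ
      constructor
      · rintro ⟨y, hy, h⟩
        exact ⟨(y, δ * c⁻¹), ⟨(hπ _ _).1 (by simpa using h), hy⟩, rfl⟩
      · rintro ⟨⟨y, γ⟩, ⟨h, hy⟩, hγ⟩
        refine ⟨y, hy, ?_⟩
        rw [(hπ y γ).2 h, show γ = δ * c⁻¹ from hγ, inv_mul_cancel_right]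
    rw [this]
    refine (isClosedMap_snd_of_compactSpace _ ?_).preimage (continuous_mul_const c⁻¹)
    exact (isClosed_orbitCorrespondence x).inter (hB.preimage continuous_fst)
  have hsurj : Function.Surjective π := by
    intro q
    obtain ⟨δ, rfl⟩ := cosetMk_surjective K q
    obtain ⟨y, hy⟩ := exists_mem_orbitCorrespondence_snd x (δ * c⁻¹)
    exact ⟨y, by simpa using (hπ _ _).2 hy⟩
  have hsmul : ∀ (g : G) (y : X), π (g • y) = g • π y := by
    intro g y
    rw [(hπ _ _).2 (smul_mem_orbitCorrespondence (hτ y) g), mul_assoc, ← smul_cosetMk]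
  refine ⟨π, ⟨hcont, hsurj, hsmul⟩, isEquicontinuousSystem_profCosetSpace K, ?_⟩
  intro Z _ _ _ _ φ hφ he
  have hφπ : ∀ y z, π y = π z → φ y = φ z := fun y z h =>
    hr.factor_eq ((hπ y (τ z)).1 h) (hτ z) hφ he
  let σ := Function.surjInv hsurj
  have hψ : ∀ y, φ (σ (π y)) = φ y := fun y => hφπ _ _ (Function.surjInv_eq hsurj _)
  refine ⟨φ ∘ σ, ⟨?_, fun z => ?_, fun g q => ?_⟩, hψ⟩
  · rw [(hclosed.isQuotientMap hcont hsurj).continuous_iff]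
    exact hφ.continuous.congr fun y => (hψ y).symm
  · obtain ⟨y, rfl⟩ := hφ.surjective z
    exact ⟨π y, hψ y⟩
  · obtain ⟨y, rfl⟩ := hsurj q
    change φ (σ (g • π y)) = g • φ (σ (π y))
    rw [← hsmul, hψ, hψ, hφ.map_smul]

theorem IsMaximalEquicontinuousFactor.exists_isFactorMap_iff {K : Subgroup (ProfCompletion G)}
    {π : X → ProfCosetSpace K} (hπ : IsMaximalEquicontinuousFactor G π)
    (V : OpenSubgroup (ProfCompletion G)) :
    (∃ φ : X → ProfCosetSpace (V : Subgroup (ProfCompletion G)), IsFactorMap G φ) ↔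
      ∃ c : ProfCompletion G, ∀ k ∈ K, c * k * c⁻¹ ∈ V := by
  constructor
  · rintro ⟨φ, hφ⟩
    obtain ⟨ψ, hψ, -⟩ := hπ.maximal _ φ hφ (isEquicontinuousSystem_profCosetSpace _)
    exact hψ.exists_conj_mem
  · rintro ⟨c, hc⟩
    obtain ⟨ψ, hψ⟩ := exists_isFactorMap_profCosetSpace (L := V.toSubgroup) hc
    exact ⟨_, hψ.comp hπ.isFactorMap⟩

/-- The maximal equicontinuous factor of the orbit closure of a regularly recurrent point is
recognized by the finite factors of the system. -/
theorem IsRegularlyRecurrent.exists_isMaximalEquicontinuousFactor_iff [CompactSpace X] [T2Space X]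
    [ContinuousConstSMul G X] {x : X} (hr : IsRegularlyRecurrent G x)
    (hx : DenseRange fun g : G => g • x) {K : Subgroup (ProfCompletion G)}
    (hK : IsClosed (K : Set (ProfCompletion G))) :
    (∃ π : X → ProfCosetSpace K, IsMaximalEquicontinuousFactor G π) ↔
      ∀ V : OpenSubgroup (ProfCompletion G),
        (∃ φ : X → ProfCosetSpace (V : Subgroup (ProfCompletion G)), IsFactorMap G φ) ↔
          ∃ c : ProfCompletion G, ∀ k ∈ K, c * k * c⁻¹ ∈ V := by
  refine ⟨fun ⟨π, hπ⟩ => hπ.exists_isFactorMap_iff, fun hV => ?_⟩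
  have h1 := self_one_mem_orbitCorrespondence (G := G) x
  let L : Subgroup (ProfCompletion G) :=
    { carrier := {γ | (x, γ) ∈ orbitCorrespondence G x}
      one_mem' := h1
      mul_mem' := fun ha hb => mul_mem_orbitCorrespondence ha hb
      inv_mem' := fun {a} ha => by simpa using hr.inv_mul_mem ha h1 }
  have hL : IsClosed (L : Set (ProfCompletion G)) :=
    (isClosed_orbitCorrespondence x).preimage (by fun_prop : Continuous fun γ => (x, γ))
  obtain ⟨π, hπ⟩ := hr.exists_isMaximalEquicontinuousFactor hx (K := L) (c := 1)
    fun γ => by rw [one_mul, inv_one, mul_one]; rfl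
  have hLK : ∀ V : OpenSubgroup (ProfCompletion G),
      (∃ c : ProfCompletion G, ∀ k ∈ L, c * k * c⁻¹ ∈ V) ↔
        ∃ c : ProfCompletion G, ∀ k ∈ K, c * k * c⁻¹ ∈ V :=
    fun V => (hπ.exists_isFactorMap_iff V).symm.trans (hV V)
  obtain ⟨a, ha⟩ := Subgroup.exists_conj_le_of_forall_openSubgroup (K := K) hL
    fun V hLV => (hLK V).1 ⟨1, fun k hk => by simpa using hLV hk⟩
  obtain ⟨b, hb⟩ := Subgroup.exists_conj_le_of_forall_openSubgroup (K := L) hK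
    fun V hKV => (hLK V).2 ⟨1, fun k hk => by simpa using hKV hk⟩
  -- `K` is conjugate into `L` by `a`, and `L` into `K` by `b`; hence `a * K * a⁻¹ = L`.
  have hba : ∀ γ, a * γ * a⁻¹ ∈ L → (b * a) * γ * (b * a)⁻¹ ∈ K := fun γ hγ => by
    simpa [mul_assoc] using hb _ hγ
  refine hr.exists_isMaximalEquicontinuousFactor hx (c := a) fun γ => ⟨ha γ, fun hγ => ?_⟩
  have := Subgroup.conj_inv_mem_of_conj_mem hK (fun k hk => hba k (ha k hk)) _ (hba γ hγ)
  simpa [mul_assoc] using this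

end MaximalEquicontinuousFactor

/-! ### Toeplitz words and locally periodic words -/

section Toeplitz

variable {G : Type u} [Group G]

theorem continuous_shift (g : G) : Continuous (shift g : (G → Bool) → G → Bool) :=
  continuous_pi fun h => continuous_apply (g⁻¹ * h)

theorem shift_mul (a b : G) (x : G → Bool) : shift (a * b) x = shift a (shift b x) := by
  funext h
  simp [shift, mul_assoc]

theorem isToeplitzWord_iff {x : G → Bool} :
    IsToeplitzWord x ↔ ∀ g, ∃ H : Subgroup G, H.FiniteIndex ∧ ∀ h ∈ H, x (g * h) = x g := by
  unfold IsToeplitzWord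
  rw [@continuous_def _ _ (profiniteTopology G)]
  constructor
  · exact fun hx g => hx {x g} (isOpen_discrete _) g rfl
  · intro hx U _ g hg
    obtain ⟨H, hH, hxH⟩ := hx g
    exact ⟨H, hH, fun h hh => by rwa [mem_preimage, hxH h hh]⟩

/-- If `x` is constant on `gH`, then so are its translates by elements of `gHg⁻¹`. -/
theorem shift_apply_mul_of_mem_comap_conj {x : G → Bool} {g : G} {H : Subgroup G}
    (hx : ∀ h ∈ H, x (g * h) = x g) {l h : G}
    (hl : l ∈ H.comap (MulAut.conj g⁻¹).toMonoidHom) (hh : h ∈ H) :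
    shift l x (g * h) = x g := by
  have hl' : g⁻¹ * l⁻¹ * g ∈ H := by simpa [mul_assoc] using H.inv_mem hl
  rw [← hx _ (H.mul_mem hl' hh)]
  simp [shift, mul_assoc]

instance (H : Subgroup G) [H.FiniteIndex] (g : G) :
    (H.comap (MulAut.conj g).toMonoidHom).FiniteIndex where
  index_ne_zero := by
    rw [H.index_comap_of_surjective (MulAut.conj g).surjective]
    exact Subgroup.FiniteIndex.index_ne_zero

theorem IsToeplitzWord.shift {x : G → Bool} (hx : IsToeplitzWord x) (g : G) :
    IsToeplitzWord (shift g x) := by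
  rw [isToeplitzWord_iff] at hx ⊢
  intro k
  obtain ⟨H, hH, h⟩ := hx (g⁻¹ * k)
  exact ⟨H, hH, fun a ha => by simpa [_root_.shift, mul_assoc] using h a ha⟩

instance (S : SubshiftSpace G) : CompactSpace S.Points :=
  isCompact_iff_compactSpace.1 S.1.isCompact

instance (S : SubshiftSpace G) : T2Space S.Points :=
  inferInstanceAs (T2Space {x : G → Bool // x ∈ S.1})

instance (S : SubshiftSpace G) : ContinuousConstSMul G S.Points where
  continuous_const_smul g :=
    ((continuous_shift g).comp continuous_subtype_val).subtype_mk _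

theorem IsToeplitzWord.isRegularlyRecurrent {S : SubshiftSpace G} {x : S.Points}
    (hx : IsToeplitzWord x.1) : IsRegularlyRecurrent G x := by
  refine tendsto_subtype_rng.2 (tendsto_pi_nhds.2 fun k => ?_)
  obtain ⟨H, hH, h⟩ := isToeplitzWord_iff.1 hx k
  refine tendsto_nhds_of_eventually_eq ?_
  filter_upwards [comap_toProfCompletion_nhds_one_le (H.comap (MulAut.conj k⁻¹).toMonoidHom)]
    with g hg
  have := shift_apply_mul_of_mem_comap_conj h hg H.one_mem
  rwa [mul_one] at this

theorem denseRange_smul_of_eq_closure {S : SubshiftSpace G} {x : S.Points}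
    (hS : (S.1 : Set (G → Bool)) = closure (range fun g : G => shift g x.1)) :
    DenseRange fun g : G => g • x := by
  refine Subtype.dense_iff.2 (hS.le.trans (closure_mono ?_))
  rintro _ ⟨g, rfl⟩
  exact ⟨g • x, ⟨g, rfl⟩, rfl⟩

open Pointwise in
/-- In a Baire `G`-space, a point with dense orbit is interior to the closure of its orbit under
a finite index subgroup: finitely many translates of this closure cover the space. -/
theorem mem_interior_closure_smul {X : Type*} [TopologicalSpace X] [BaireSpace X] [MulAction G X]
    [ContinuousConstSMul G X] {x : X} (hx : DenseRange fun g : G => g • x) (H : Subgroup G)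
    [H.FiniteIndex] : x ∈ interior (closure ((fun h : G => h • x) '' H)) := by
  set A : Set X := (fun h : G => h • x) '' H
  have : Finite (G ⧸ H) := Subgroup.finite_quotient_of_finiteIndex
  have : Nonempty X := ⟨x⟩
  have hcover : ⋃ q : G ⧸ H, q.out • closure A = univ := by
    refine (isClosed_iUnion_of_finite fun q => isClosed_closure.smul _).closure_eq.symm.trans
      (hx.mono ?_).closure_eq
    rintro _ ⟨g, rfl⟩
    refine mem_iUnion.2 ⟨g, mem_smul_set_iff_inv_smul_mem.2 (subset_closure ?_)⟩
    exact ⟨(g : G ⧸ H).out⁻¹ * g,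
      QuotientGroup.eq.1 (QuotientGroup.out_eq' (g : G ⧸ H)), mul_smul _ _ _⟩
  obtain ⟨q, hq⟩ := nonempty_interior_of_iUnion_of_closed
    (fun q : G ⧸ H => isClosed_closure.smul q.out) hcover
  rw [interior_smul, smul_set_nonempty] at hq
  obtain ⟨_, hy, h, hh, rfl⟩ :=
    mem_closure_iff.1 (interior_subset hq.some_mem) _ isOpen_interior hq.some_mem
  have hA : h • A = A := by
    ext y
    rw [mem_smul_set_iff_inv_smul_mem]
    constructor
    · rintro ⟨k, hk, hky⟩
      exact ⟨h * k, H.mul_mem hh hk, by simp only [mul_smul, hky, smul_inv_smul]⟩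
    · rintro ⟨k, hk, rfl⟩
      exact ⟨h⁻¹ * k, H.mul_mem (H.inv_mem hh) hk, mul_smul _ _ _⟩
  rwa [← hA, closure_smul, interior_smul, smul_mem_smul_set_iff] at hy

/-- The words which are constant on `gH` for some subgroup `H` such that `T` meets all left
cosets of `H`. -/
def locallyPeriodicWords (g : G) (T : Finset G) : Set (G → Bool) :=
  {x | ∃ H : Subgroup G, (∀ k, ∃ t ∈ T, t⁻¹ * k ∈ H) ∧ ∀ h ∈ H, x (g * h) = x g}

/-- The set is a projection of a closed set of pairs `(x, H)`, where `H` runs over the compact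
space of subgroups of `G`. -/
theorem isClosed_locallyPeriodicWords (g : G) (T : Finset G) :
    IsClosed (locallyPeriodicWords g T) := by
  let P : Set ((G → Bool) × (G → Bool)) :=
    {p | p.2 1 = true} ∩ {p | ∀ a b, p.2 a = true → p.2 b = true → p.2 (a * b) = true} ∩
      {p | ∀ a, p.2 a = true → p.2 a⁻¹ = true} ∩ {p | ∀ k, ∃ t ∈ T, p.2 (t⁻¹ * k) = true} ∩
      {p | ∀ h, p.2 h = true → p.1 (g * h) = p.1 g}
  have hP : IsClosed P := by
    have h2 : ∀ a, Continuous fun p : (G → Bool) × (G → Bool) => p.2 a := fun a => by fun_prop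
    have h1 : ∀ a, Continuous fun p : (G → Bool) × (G → Bool) => p.1 a := fun a => by fun_prop
    refine ((((?_ : IsClosed _).inter ?_).inter ?_).inter ?_).inter ?_
    · exact (isClosed_discrete {true}).preimage (h2 1)
    · simp only [ofPred_forall]
      exact isClosed_iInter fun a => isClosed_iInter fun b => (isClosed_discrete
        {q : Bool × Bool × Bool | q.1 = true → q.2.1 = true → q.2.2 = true}).preimage
        ((h2 a).prodMk ((h2 b).prodMk (h2 (a * b))))
    · simp only [ofPred_forall]
      exact isClosed_iInter fun a => (isClosed_discrete
        {q : Bool × Bool | q.1 = true → q.2 = true}).preimage ((h2 a).prodMk (h2 a⁻¹))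
    · simp only [ofPred_forall]
      refine isClosed_iInter fun k => ?_
      have : {p : (G → Bool) × (G → Bool) | ∃ t ∈ T, p.2 (t⁻¹ * k) = true} =
          ⋃ t ∈ T, {p | p.2 (t⁻¹ * k) = true} := by
        ext p
        simp
      rw [this]
      exact isClosed_biUnion_finset fun t _ =>
        (isClosed_discrete {true}).preimage (h2 (t⁻¹ * k))
    · simp only [ofPred_forall]
      exact isClosed_iInter fun h => (isClosed_discrete
        {q : Bool × Bool × Bool | q.1 = true → q.2.1 = q.2.2}).preimage
        ((h2 h).prodMk ((h1 (g * h)).prodMk (h1 g)))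
  have : locallyPeriodicWords g T = Prod.fst '' P := by
    classical
    ext x
    constructor
    · rintro ⟨H, hT, hx⟩
      refine ⟨(x, fun h => decide (h ∈ H)), ⟨⟨⟨⟨?_, ?_⟩, ?_⟩, ?_⟩, ?_⟩, rfl⟩
      · simp
      · simpa using fun a b => H.mul_mem
      · simp
      · simpa using hT
      · simpa using hx
    · rintro ⟨⟨x, b⟩, ⟨⟨⟨⟨h1, hmul⟩, hinv⟩, hT⟩, hx⟩, rfl⟩
      exact ⟨{ carrier := {a | b a = true}
               one_mem' := h1
               mul_mem' := hmul _ _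
               inv_mem' := hinv _ }, hT, hx⟩
  rw [this]
  exact isClosedMap_fst_of_compactSpace _ hP

theorem exists_finset_of_finiteIndex (H : Subgroup G) [H.FiniteIndex] :
    ∃ T : Finset G, ∀ k, ∃ t ∈ T, t⁻¹ * k ∈ H := by
  have : Finite (G ⧸ H) := Subgroup.finite_quotient_of_finiteIndex
  refine ⟨(finite_range (Quotient.out : G ⧸ H → G)).toFinset, fun k => ?_⟩
  refine ⟨(k : G ⧸ H).out, by simp, ?_⟩
  rw [← QuotientGroup.eq, QuotientGroup.out_eq']

theorem finiteIndex_of_finset {H : Subgroup G} {T : Finset G} (hT : ∀ k, ∃ t ∈ T, t⁻¹ * k ∈ H) :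
    H.FiniteIndex := by
  have : Finite (G ⧸ H) := Finite.of_surjective (fun t : T => ((t : G) : G ⧸ H)) fun q => by
    obtain ⟨k, rfl⟩ := QuotientGroup.mk_surjective q
    obtain ⟨t, ht, h⟩ := hT k
    exact ⟨⟨t, ht⟩, QuotientGroup.eq.2 h⟩
  exact Subgroup.finiteIndex_of_finite_quotient

theorem isToeplitzWord_of_forall_mem {x : G → Bool}
    (hx : ∀ g, ∃ T, x ∈ locallyPeriodicWords g T) : IsToeplitzWord x := by
  refine isToeplitzWord_iff.2 fun g => ?_
  obtain ⟨T, H, hT, h⟩ := hx g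
  exact ⟨H, finiteIndex_of_finset hT, h⟩

end Toeplitz

/-! ### Subshifts, Toeplitz subshifts and finite factors in terms of open sets -/

section Characterization

variable {G : Type u} [Group G]

/-- A compact set `C` of words is generically Toeplitz if it is nonempty, topologically transitive
for the shift, and if for each `g` every nonempty open subset of `C` contains a smaller one
contained in `locallyPeriodicWords g T` for some `T`. Everything is phrased in terms of which open
sets `C` meets, so that the condition is visibly Borel in `C`. -/
def IsGenericallyToeplitz [Countable G] (C : Compacts (G → Bool)) : Prop :=
  ((C : Set (G → Bool)) ∩ univ).Nonempty ∧
    (∀ U V : countableBasis (G → Bool), ((C : Set (G → Bool)) ∩ U).Nonempty →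
      ((C : Set (G → Bool)) ∩ V).Nonempty →
        ∃ g : G, ((C : Set (G → Bool)) ∩ (U ∩ shift g ⁻¹' V)).Nonempty) ∧
    ∀ (g : G) (U : countableBasis (G → Bool)), ((C : Set (G → Bool)) ∩ U).Nonempty →
      ∃ (T : Finset G) (V : countableBasis (G → Bool)), (V : Set (G → Bool)) ⊆ U ∧
        ((C : Set (G → Bool)) ∩ V).Nonempty ∧
        ¬ ((C : Set (G → Bool)) ∩ (V \ locallyPeriodicWords g T)).Nonempty

/-- If `x` is a Toeplitz word with dense orbit which is constant on `gH`, then the closure of its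
orbit under `gHg⁻¹` consists of words constant on `gH` and is a neighbourhood of `x`. -/
theorem IsToeplitzSubshift.isGenericallyToeplitz [Countable G] {S : SubshiftSpace G}
    (h : IsToeplitzSubshift S) : IsGenericallyToeplitz S.1 := by
  have hB := isBasis_countableBasis (G → Bool)
  obtain ⟨x, hx, hS⟩ := h
  have hxS : ∀ g : G, shift g x ∈ (S.1 : Set (G → Bool)) := fun g => by
    rw [hS]
    exact subset_closure ⟨g, rfl⟩
  have hmeet : ∀ U : countableBasis (G → Bool), ((S.1 : Set (G → Bool)) ∩ U).Nonempty →
      ∃ g : G, shift g x ∈ (U : Set (G → Bool)) := by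
    rintro U ⟨y, hy, hyU⟩
    rw [hS] at hy
    obtain ⟨_, hU, g, rfl⟩ := mem_closure_iff.1 hy U (hB.isOpen U.2) hyU
    exact ⟨g, hU⟩
  refine ⟨⟨_, hxS 1, trivial⟩, fun U V hU hV => ?_, fun g U hU => ?_⟩
  · obtain ⟨a, ha⟩ := hmeet U hU
    obtain ⟨b, hb⟩ := hmeet V hV
    refine ⟨b * a⁻¹, _, hxS a, ha, ?_⟩
    rwa [mem_preimage, ← shift_mul, inv_mul_cancel_right]
  · obtain ⟨a, ha⟩ := hmeet U hU
    let y : S.Points := ⟨shift a x, hxS a⟩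
    have hy : DenseRange fun g : G => g • y := by
      refine denseRange_smul_of_eq_closure ?_
      rw [hS]
      congr 1
      ext z
      constructor
      · rintro ⟨k, rfl⟩
        exact ⟨k * a⁻¹, by simp [y, ← shift_mul]⟩
      · rintro ⟨k, rfl⟩
        exact ⟨k * a, shift_mul _ _ _⟩
    obtain ⟨H, hH, hyH⟩ := isToeplitzWord_iff.1 (hx.shift a) g
    obtain ⟨T, hT⟩ := exists_finset_of_finiteIndex H
    have hint := mem_interior_closure_smul hy (H.comap (MulAut.conj g⁻¹).toMonoidHom)
    have hsub : closure ((fun h : G => h • y) '' (H.comap (MulAut.conj g⁻¹).toMonoidHom)) ⊆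
        (Subtype.val : S.Points → G → Bool) ⁻¹' locallyPeriodicWords g T := by
      refine closure_minimal ?_
        ((isClosed_locallyPeriodicWords g T).preimage continuous_subtype_val)
      rintro _ ⟨l, hl, rfl⟩
      refine ⟨H, hT, fun h hh => ?_⟩
      have h1 := shift_apply_mul_of_mem_comap_conj hyH hl hh
      have h2 := shift_apply_mul_of_mem_comap_conj hyH hl H.one_mem
      rw [mul_one] at h2
      exact h1.trans h2.symm
    obtain ⟨O, hO, hOint⟩ := isOpen_induced_iff.1 (isOpen_interior (s := closure
      ((fun h : G => h • y) '' (H.comap (MulAut.conj g⁻¹).toMonoidHom))))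
    have hyO : y.1 ∈ O ∩ U := ⟨by rw [← hOint] at hint; exact hint, ha⟩
    obtain ⟨V, hV, hyV, hVO⟩ := hB.exists_subset_of_mem_open hyO (hO.inter (hB.isOpen U.2))
    refine ⟨T, ⟨V, hV⟩, hVO.trans inter_subset_right, ⟨y.1, hxS a, hyV⟩, ?_⟩
    rintro ⟨z, hzS, hzV, hz⟩
    have hzO : (⟨z, hzS⟩ : S.Points) ∈ interior (closure
        ((fun h : G => h • y) '' (H.comap (MulAut.conj g⁻¹).toMonoidHom))) :=
      hOint ▸ (hVO hzV).1
    exact hz (hsub (interior_subset hzO))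

/-- By the Baire category theorem, a generically Toeplitz subshift contains a Toeplitz word with
dense orbit. -/
theorem IsGenericallyToeplitz.isToeplitzSubshift [Countable G] {S : SubshiftSpace G}
    (h : IsGenericallyToeplitz S.1) : IsToeplitzSubshift S := by
  have hB := isBasis_countableBasis (G → Bool)
  obtain ⟨⟨x₀, hx₀, -⟩, htrans, hper⟩ := h
  have : Nonempty S.Points := ⟨⟨x₀, hx₀⟩⟩
  have hval : Continuous (Subtype.val : S.Points → G → Bool) := continuous_subtype_val
  -- A nonempty open subset of `S` contains the trace of a basic open set which meets `S`.
  have hbasic : ∀ W : Set S.Points, IsOpen W → W.Nonempty → ∃ U : countableBasis (G → Bool),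
      ((S.1 : Set (G → Bool)) ∩ U).Nonempty ∧ Subtype.val ⁻¹' (U : Set (G → Bool)) ⊆ W := by
    rintro W hW ⟨z, hz⟩
    obtain ⟨O, hO, rfl⟩ := isOpen_induced_iff.1 hW
    obtain ⟨U, hU, hzU, hUO⟩ := hB.exists_subset_of_mem_open hz hO
    exact ⟨⟨U, hU⟩, ⟨z.1, z.2, hzU⟩, preimage_mono hUO⟩
  have h1 : ∀ᶠ y : S.Points in residual S.Points, ∀ V : countableBasis (G → Bool),
      ((S.1 : Set (G → Bool)) ∩ V).Nonempty → ∃ g : G, shift g y.1 ∈ (V : Set (G → Bool)) := by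
    refine eventually_countable_forall.2 fun V => ?_
    by_cases hV : ((S.1 : Set (G → Bool)) ∩ V).Nonempty
    swap
    · exact Filter.Eventually.of_forall fun _ h => absurd h hV
    have hopen : IsOpen {y : S.Points | ∃ g : G, shift g y.1 ∈ (V : Set (G → Bool))} := by
      simp only [ofPred_exists]
      exact isOpen_iUnion fun g => (hB.isOpen V.2).preimage ((continuous_shift g).comp hval)
    refine Filter.mem_of_superset (residual_of_dense_open hopen ?_) fun y hy _ => hy
    refine dense_iff_inter_open.2 fun W hW hne => ?_
    obtain ⟨U, hU, hUW⟩ := hbasic W hW hne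
    obtain ⟨g, z, hz, hzU, hzV⟩ := htrans U V hU hV
    exact ⟨⟨z, hz⟩, hUW hzU, g, hzV⟩
  have h2 : ∀ᶠ y : S.Points in residual S.Points, ∀ g : G,
      ∃ T, y.1 ∈ locallyPeriodicWords g T := by
    refine eventually_countable_forall.2 fun g => ?_
    let D : Set S.Points := ⋃ T, interior (Subtype.val ⁻¹' locallyPeriodicWords g T)
    have hD : IsOpen D := isOpen_iUnion fun T => isOpen_interior
    refine Filter.mem_of_superset (residual_of_dense_open hD ?_) fun y hy => ?_
    · refine dense_iff_inter_open.2 fun W hW hne => ?_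
      obtain ⟨U, hU, hUW⟩ := hbasic W hW hne
      obtain ⟨T, V, hVU, ⟨z, hz, hzV⟩, hVT⟩ := hper g U hU
      refine ⟨⟨z, hz⟩, hUW (hVU hzV), mem_iUnion.2 ⟨T, ?_⟩⟩
      refine mem_interior.2 ⟨Subtype.val ⁻¹' (V : Set (G → Bool)), fun y hy => ?_,
        (hB.isOpen V.2).preimage hval, hzV⟩
      by_contra hn
      exact hVT ⟨y.1, y.2, hy, hn⟩
    · obtain ⟨T, hT⟩ := mem_iUnion.1 hy
      exact ⟨T, interior_subset (s := (Subtype.val : S.Points → G → Bool) ⁻¹' _) hT⟩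
  obtain ⟨y, hy1, hy2⟩ := (dense_of_mem_residual (h1.and h2)).nonempty
  refine ⟨y.1, isToeplitzWord_of_forall_mem hy2, Subset.antisymm (fun z hz => ?_) ?_⟩
  · refine hB.mem_closure_iff.2 fun V hV hzV => ?_
    obtain ⟨g, hg⟩ := hy1 ⟨V, hV⟩ ⟨z, hz, hzV⟩
    exact ⟨_, hg, g, rfl⟩
  · refine closure_minimal ?_ S.1.isCompact.isClosed
    rintro _ ⟨g, rfl⟩
    exact S.2 g y.1 y.2

theorem isToeplitzSubshift_iff [Countable G] {S : SubshiftSpace G} :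
    IsToeplitzSubshift S ↔ IsGenericallyToeplitz S.1 :=
  ⟨fun h => h.isGenericallyToeplitz, fun h => h.isToeplitzSubshift⟩

theorem isSubshift_iff [Countable G] (C : Compacts (G → Bool)) :
    IsSubshift C ↔ ∀ (g : G) (U : countableBasis (G → Bool)),
      ((C : Set (G → Bool)) ∩ shift g ⁻¹' U).Nonempty → ((C : Set (G → Bool)) ∩ U).Nonempty := by
  constructor
  · rintro hC g U ⟨x, hx, hxU⟩
    exact ⟨_, hC g x hx, hxU⟩
  · intro h g x hx
    by_contra hn
    obtain ⟨U, hU, hxU, hUC⟩ := (isBasis_countableBasis (G → Bool)).exists_subset_of_mem_open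
      (show shift g x ∈ (C : Set (G → Bool))ᶜ from hn) C.isCompact.isClosed.isOpen_compl
    obtain ⟨y, hy, hyU⟩ := h g ⟨U, hU⟩ ⟨x, hx, hxU⟩
    exact hUC hyU hy

/-- A continuous map from a closed set of words to a discrete space depends only on finitely many
coordinates. -/
theorem exists_finset_forall_eq_of_continuous {ι : Type*} {C : Set (ι → Bool)} (hC : IsCompact C)
    {Y : Type*} [TopologicalSpace Y] [DiscreteTopology Y] {φ : C → Y} (hφ : Continuous φ) :
    ∃ F : Finset ι, ∀ x y : C, (∀ i ∈ F, x.1 i = y.1 i) → φ x = φ y := by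
  have : CompactSpace C := isCompact_iff_compactSpace.1 hC
  have hK : IsCompact {p : C × C | φ p.1 ≠ φ p.2} :=
    ((isClosed_discrete {q : Y × Y | q.1 ≠ q.2}).preimage
      ((hφ.comp continuous_fst).prodMk (hφ.comp continuous_snd))).isCompact
  obtain ⟨F, hF⟩ := hK.elim_finite_subcover (fun i : ι => {p : C × C | p.1.1 i ≠ p.2.1 i})
    (fun i => (isOpen_discrete {q : Bool × Bool | q.1 ≠ q.2}).preimage
      (f := fun p : C × C => (p.1.1 i, p.2.1 i))
      (((continuous_apply i).comp (continuous_subtype_val.comp continuous_fst)).prodMk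
        ((continuous_apply i).comp (continuous_subtype_val.comp continuous_snd)))) fun p hp => by
        by_contra hn
        refine hp (congrArg φ (Subtype.ext (funext fun i => ?_)))
        by_contra hi
        exact hn (mem_iUnion.2 ⟨i, hi⟩)
  refine ⟨F, fun x y hxy => ?_⟩
  by_contra hne
  obtain ⟨i, hi, hn⟩ := mem_iUnion₂.1 (hF (show (x, y) ∈ {p : C × C | φ p.1 ≠ φ p.2} from hne))
  exact hn (hxy i hi)

/-- The restriction of a word to a finite window `F`. -/
def window {ι : Type*} (F : Finset ι) (x : ι → Bool) : F → Bool := fun i => x i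

theorem continuous_window {ι : Type*} (F : Finset ι) : Continuous (window F) :=
  continuous_pi fun i => continuous_apply (i : ι)

/-- A factor map onto a discrete system is given by a block map `p`, and whether `p` defines a factor
map of `C` depends only on which of certain open sets `C` meets. -/
theorem exists_isFactorMap_iff {C : Compacts (G → Bool)} (hC : IsSubshift C) {Y : Type u}
    [TopologicalSpace Y] [DiscreteTopology Y] [Nonempty Y] [MulAction G Y] :
    (∃ φ : SubshiftSpace.Points ⟨C, hC⟩ → Y, IsFactorMap G φ) ↔
      ∃ (F : Finset G) (p : (F → Bool) → Y),
        (∀ g : G, ¬ ((C : Set (G → Bool)) ∩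
          {x | p (window F (shift g x)) ≠ g • p (window F x)}).Nonempty) ∧
        ∀ q : Y, ((C : Set (G → Bool)) ∩ {x | p (window F x) = q}).Nonempty := by
  classical
  constructor
  · rintro ⟨φ, hφ⟩
    obtain ⟨F, hF⟩ := exists_finset_forall_eq_of_continuous C.isCompact hφ.continuous
    let p : (F → Bool) → Y := fun w =>
      if h : ∃ x : SubshiftSpace.Points ⟨C, hC⟩, window F x.1 = w then φ h.choose else Classical.arbitrary Y
    have hp : ∀ x : SubshiftSpace.Points ⟨C, hC⟩, p (window F x.1) = φ x := fun x => by
      have h : ∃ y : SubshiftSpace.Points ⟨C, hC⟩, window F y.1 = window F x.1 := ⟨x, rfl⟩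
      change dite _ _ _ = _
      rw [dif_pos h]
      exact hF _ _ fun i hi => congrFun h.choose_spec ⟨i, hi⟩
    refine ⟨F, p, fun g => ?_, fun q => ?_⟩
    · rintro ⟨x, hx, hne⟩
      refine hne ?_
      let x' : SubshiftSpace.Points ⟨C, hC⟩ := ⟨x, hx⟩
      exact (hp (g • x')).trans ((hφ.map_smul g x').trans (congrArg _ (hp x').symm))
    · obtain ⟨x, rfl⟩ := hφ.surjective q
      exact ⟨x.1, x.2, hp x⟩
  · rintro ⟨F, p, hequi, hsurj⟩
    refine ⟨fun x => p (window F x.1), ?_, fun q => ?_, fun g x => ?_⟩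
    · exact continuous_of_discreteTopology.comp
        ((continuous_window F).comp continuous_subtype_val)
    · obtain ⟨x, hx, hq⟩ := hsurj q
      exact ⟨⟨x, hx⟩, hq⟩
    · by_contra hn
      exact hequi g ⟨x.1, x.2, hn⟩

end Characterization

/-! ### Borel measurability -/

section BorelMeasurability

variable {G : Type u} [Group G]

/-- The sets that meet a given open set form a basic open set of the Vietoris topology. -/
theorem measurable_meets {α : Type*} [TopologicalSpace α] {U : Set α} (hU : IsOpen U) :
    Measurable[borel (Compacts α)] fun C : Compacts α => ((C : Set α) ∩ U).Nonempty := by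
  let _ := borel (Compacts α)
  have : BorelSpace (Compacts α) := ⟨rfl⟩
  exact measurableSet_setOfPred.1 (Compacts.isOpen_inter_nonempty_of_isOpen hU).measurableSet

theorem measurable_isSubshift [Countable G] :
    Measurable[borel (Compacts (G → Bool))] fun C : Compacts (G → Bool) => IsSubshift C := by
  let _ := borel (Compacts (G → Bool))
  have hB := isBasis_countableBasis (G → Bool)
  simp only [isSubshift_iff]
  exact .forall fun g => .forall fun U =>
    (measurable_meets ((hB.isOpen U.2).preimage (continuous_shift g))).imp
      (measurable_meets (hB.isOpen U.2))

theorem measurable_isGenericallyToeplitz [Countable G] :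
    Measurable[borel (Compacts (G → Bool))]
      (IsGenericallyToeplitz : Compacts (G → Bool) → Prop) := by
  let _ := borel (Compacts (G → Bool))
  have hB := isBasis_countableBasis (G → Bool)
  refine (measurable_meets isOpen_univ).and (.and ?_ ?_)
  · exact .forall fun U => .forall fun V => (measurable_meets (hB.isOpen U.2)).imp
      ((measurable_meets (hB.isOpen V.2)).imp (.exists fun g => measurable_meets
        ((hB.isOpen U.2).inter ((hB.isOpen V.2).preimage (continuous_shift g)))))
  · exact .forall fun g => .forall fun U => (measurable_meets (hB.isOpen U.2)).imp
      (.exists fun T => .exists fun V => measurable_const.and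
        ((measurable_meets (hB.isOpen V.2)).and (measurable_meets
          ((hB.isOpen V.2).sdiff (isClosed_locallyPeriodicWords g T))).not))

theorem measurable_isToeplitzSubshift [Countable G] :
    Measurable[borel (Compacts (G → Bool))]
      fun C : Compacts (G → Bool) => ∃ hC : IsSubshift C, IsToeplitzSubshift ⟨C, hC⟩ := by
  let _ := borel (Compacts (G → Bool))
  simp only [isToeplitzSubshift_iff, exists_prop]
  exact Measurable.and measurable_isSubshift measurable_isGenericallyToeplitz

theorem measurable_exists_isFactorMap [Countable G] {Y : Type u} [TopologicalSpace Y]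
    [DiscreteTopology Y] [Finite Y] [Nonempty Y] [MulAction G Y] :
    Measurable[borel (Compacts (G → Bool))]
      fun C : Compacts (G → Bool) => ∃ hC : IsSubshift C,
        ∃ φ : SubshiftSpace.Points ⟨C, hC⟩ → Y, IsFactorMap G φ := by
  let _ := borel (Compacts (G → Bool))
  simp only [exists_isFactorMap_iff, exists_prop]
  refine Measurable.and measurable_isSubshift (.exists fun F => .exists fun p => .and ?_ ?_)
  · refine .forall fun g => (measurable_meets ?_).not
    exact (isOpen_discrete {q : (F → Bool) × (F → Bool) | p q.1 ≠ g • p q.2}).preimage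
      (((continuous_window F).comp (continuous_shift g)).prodMk (continuous_window F))
  · exact .forall fun q => measurable_meets
      ((isOpen_discrete (p ⁻¹' {q})).preimage (continuous_window F))

end BorelMeasurability

theorem proposition2p5 {G : Type u} [Group G] [Countable G] [Group.ResiduallyFinite G] :
    MeasurableSet[borel (SubshiftSpace G)] (toeplitzSubshifts G) ∧
      (MetrizableSpace (ProfCompletion G) →
        ∀ K : Subgroup (ProfCompletion G), IsClosed (K : Set (ProfCompletion G)) →
          MeasurableSet[borel (Compacts (G → Bool))] (toeplitzSubshiftsWithMEF K)) := by
  let _ := borel (Compacts (G → Bool))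
  let _ := borel (SubshiftSpace G)
  have : BorelSpace (Compacts (G → Bool)) := ⟨rfl⟩
  have : BorelSpace (SubshiftSpace G) := ⟨rfl⟩
  constructor
  · have hval : Measurable (Subtype.val : SubshiftSpace G → Compacts (G → Bool)) :=
      continuous_subtype_val.measurable
    convert hval (measurableSet_setOfPred.2 measurable_isToeplitzSubshift) using 1
    ext S
    exact ⟨fun h => ⟨S.2, h⟩, fun ⟨_, h⟩ => h⟩
  · intro _ K hK
    have : Countable (OpenSubgroup (ProfCompletion G)) := countable_openSubgroup _
    have hchar : toeplitzSubshiftsWithMEF K = {C : Compacts (G → Bool) |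
        (∃ hC : IsSubshift C, IsToeplitzSubshift ⟨C, hC⟩) ∧
          ∀ V : OpenSubgroup (ProfCompletion G),
            (∃ hC : IsSubshift C, ∃ φ : SubshiftSpace.Points ⟨C, hC⟩ →
              ProfCosetSpace (V : Subgroup (ProfCompletion G)), IsFactorMap G φ) ↔
            ∃ c : ProfCompletion G, ∀ k ∈ K, c * k * c⁻¹ ∈ V} := by
      ext C
      have key : ∀ hC : IsSubshift C, IsToeplitzSubshift ⟨C, hC⟩ →
          ((∃ π : SubshiftSpace.Points ⟨C, hC⟩ → ProfCosetSpace K,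
            IsMaximalEquicontinuousFactor G π) ↔
          ∀ V : OpenSubgroup (ProfCompletion G),
            (∃ φ : SubshiftSpace.Points ⟨C, hC⟩ →
              ProfCosetSpace (V : Subgroup (ProfCompletion G)), IsFactorMap G φ) ↔
            ∃ c : ProfCompletion G, ∀ k ∈ K, c * k * c⁻¹ ∈ V) := by
        rintro hC ⟨x, hx, hS⟩
        have hxC : x ∈ (C : Set (G → Bool)) := by
          rw [hS]
          exact subset_closure ⟨1, by simp [shift, funext_iff]⟩
        let x' : SubshiftSpace.Points ⟨C, hC⟩ := ⟨x, hxC⟩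
        exact (IsToeplitzWord.isRegularlyRecurrent (x := x')
          hx).exists_isMaximalEquicontinuousFactor_iff (denseRange_smul_of_eq_closure hS) hK
      constructor
      · rintro ⟨hC, hT, hπ⟩
        exact ⟨⟨hC, hT⟩, fun V => (exists_prop_of_true hC).trans ((key hC hT).1 hπ V)⟩
      · rintro ⟨⟨hC, hT⟩, hV⟩
        exact ⟨hC, hT, (key hC hT).2 fun V => (exists_prop_of_true hC).symm.trans (hV V)⟩
    rw [hchar]
    exact measurableSet_setOfPred.2 (measurable_isToeplitzSubshift.and
      (.forall fun V => measurable_exists_isFactorMap.iff measurable_const))
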